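/- Let $E$ be a real Banach lattice with positive cone $E^+$ and topological dual $E'$, which carries its canonical order ($f\le g$ iff $f(x)\le g(x)$ for all $x\in E^+$) and is again a Banach lattice. Let $A\subseteq E$ be a nonempty norm bounded set, with solid hull $\mathrm{sol}(A)=\{y\in E : |y|\le |x| \text{ for some } x\in A\}$. A sequence $(x_n)$ is called disjoint if $|x_m|\wedge|x_n|=0$ for all $m\ne n$. The set $A$ is called L-weakly compact if $\|x_n\|\to 0$ for every disjoint sequence $(x_n)$ in $\mathrm{sol}(A)$. A sequence $(f_n)$ in $E'$ is called uaw-null if, for every $0\le g\in E'$, the sequence $(|f_n|\wedge g)$ converges to $0$ in the weak topology of $E'$ (the topology induced by $E''$). Then the following statements are equivalent: 1. $A$ is L-weakly compact. 2. For every norm bounded uaw-null sequence $(f_n)$ in $E'$ and every sequence $(x_n)$ in $E^+\cap \mathrm{sol}(A)$ we have $f_n(x_n)\to 0$. 3. For every norm bounded uaw-null sequence $(f_n)$ in $E'$ and every disjoint sequence $(x_n)$ in $E^+\cap \mathrm{sol}(A)$ we have $f_n(x_n)\to 0$. -/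

import Mathlib

open Set Filter Topology

namespace BanachLattice

/-! ### Order structure of the topological dual of a real Banach lattice -/

section Dual

variable {E : Type*} [NormedAddCommGroup E] [NormedSpace ℝ E] [Lattice E]

/-- The canonical order of the dual: `f ≤ g` iff `f x ≤ g x` for every positive `x`. It is
antisymmetric because every `x` is a difference of positive vectors. -/
instance instPartialOrderDual [IsOrderedAddMonoid E] : PartialOrder (StrongDual ℝ E) where
  le f g := ∀ x : E, 0 ≤ x → f x ≤ g x
  le_refl _ _ _ := le_rfl
  le_trans _ _ _ h₁ h₂ x hx := (h₁ x hx).trans (h₂ x hx)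
  le_antisymm f g h₁ h₂ := by
    have key : ∀ x : E, 0 ≤ x → f x = g x := fun x hx => le_antisymm (h₁ x hx) (h₂ x hx)
    ext x
    rw [← posPart_sub_negPart x, map_sub, map_sub, key _ (posPart_nonneg x),
      key _ (negPart_nonneg x)]

theorem dual_le_def [IsOrderedAddMonoid E] {f g : StrongDual ℝ E} :
    f ≤ g ↔ ∀ x : E, 0 ≤ x → f x ≤ g x := Iff.rfl

/-- The supremum of `f` over the order interval `[0, x]`; for `x ≥ 0` this is the value at `x` of
the positive part of `f`. -/
noncomputable def supOnIcc (f : StrongDual ℝ E) (x : E) : ℝ := sSup (f '' Icc 0 x)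

theorem supOnIcc_le (f : StrongDual ℝ E) {x : E} (hx : 0 ≤ x) {c : ℝ}
    (h : ∀ y ∈ Icc 0 x, f y ≤ c) : supOnIcc f x ≤ c := by
  refine csSup_le ⟨f 0, 0, ⟨le_rfl, hx⟩, rfl⟩ ?_
  rintro _ ⟨z, hz, rfl⟩
  exact h z hz

variable [HasSolidNorm E] [IsOrderedAddMonoid E]

theorem apply_le_of_mem_Icc (f : StrongDual ℝ E) {x y : E} (hy : y ∈ Icc 0 x) :
    f y ≤ ‖f‖ * ‖x‖ := by
  have h : ‖y‖ ≤ ‖x‖ := norm_le_norm_of_abs_le_abs (by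
    rw [abs_of_nonneg hy.1, abs_of_nonneg (hy.1.trans hy.2)]; exact hy.2)
  calc f y ≤ ‖f y‖ := Real.le_norm_self _
    _ ≤ ‖f‖ * ‖y‖ := f.le_opNorm y
    _ ≤ ‖f‖ * ‖x‖ := by gcongr

theorem le_supOnIcc (f : StrongDual ℝ E) {x y : E} (hy : y ∈ Icc 0 x) :
    f y ≤ supOnIcc f x := by
  refine le_csSup ⟨‖f‖ * ‖x‖, ?_⟩ ⟨y, hy, rfl⟩
  rintro _ ⟨z, hz, rfl⟩
  exact apply_le_of_mem_Icc f hz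

theorem supOnIcc_nonneg (f : StrongDual ℝ E) {x : E} (hx : 0 ≤ x) : 0 ≤ supOnIcc f x := by
  simpa using le_supOnIcc f (x := x) (y := 0) ⟨le_rfl, hx⟩

theorem supOnIcc_add (f : StrongDual ℝ E) {a b : E} (ha : 0 ≤ a) (hb : 0 ≤ b) :
    supOnIcc f (a + b) = supOnIcc f a + supOnIcc f b := by
  apply le_antisymm
  · refine supOnIcc_le f (add_nonneg ha hb) fun y hy => ?_
    have h₁ : y ⊓ a ∈ Icc 0 a := ⟨le_inf hy.1 ha, inf_le_right⟩
    have h₂ : y - y ⊓ a ∈ Icc 0 b := by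
      refine ⟨sub_nonneg.2 inf_le_left, ?_⟩
      rw [sub_le_comm]
      refine le_inf (sub_le_self _ hb) ?_
      rw [sub_le_iff_le_add]
      exact hy.2
    have := add_le_add (le_supOnIcc f h₁) (le_supOnIcc f h₂)
    rwa [← map_add, add_sub_cancel] at this
  · rw [← le_sub_iff_add_le]
    refine supOnIcc_le f ha fun y hy => ?_
    rw [le_sub_comm]
    refine supOnIcc_le f hb fun z hz => ?_
    have := le_supOnIcc f (x := a + b) (y := y + z)
      ⟨add_nonneg hy.1 hz.1, add_le_add hy.2 hz.2⟩
    rw [map_add] at this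
    linarith

theorem supOnIcc_sub_eq (f : StrongDual ℝ E) {a b c d : E} (ha : 0 ≤ a) (hb : 0 ≤ b)
    (hc : 0 ≤ c) (hd : 0 ≤ d) (h : a - b = c - d) :
    supOnIcc f a - supOnIcc f b = supOnIcc f c - supOnIcc f d := by
  have h' : a + d = c + b := sub_eq_sub_iff_add_eq_add.1 h
  have := congrArg (supOnIcc f) h'
  rw [supOnIcc_add f ha hd, supOnIcc_add f hc hb] at this
  linarith

/-- The positive part of `f` as an additive map, before continuity is known. -/
noncomputable def posPartHom (f : StrongDual ℝ E) : E →+ ℝ where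
  toFun x := supOnIcc f x⁺ - supOnIcc f x⁻
  map_zero' := by simp
  map_add' x y := by
    rw [supOnIcc_sub_eq f (posPart_nonneg _) (negPart_nonneg _)
      (add_nonneg (posPart_nonneg x) (posPart_nonneg y))
      (add_nonneg (negPart_nonneg x) (negPart_nonneg y)),
      supOnIcc_add f (posPart_nonneg x) (posPart_nonneg y),
      supOnIcc_add f (negPart_nonneg x) (negPart_nonneg y)]
    · ring
    · rw [posPart_sub_negPart, add_sub_add_comm, posPart_sub_negPart, posPart_sub_negPart]

theorem supOnIcc_le_norm (f : StrongDual ℝ E) {x y : E} (hx : 0 ≤ x) (hxy : x ≤ |y|) :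
    supOnIcc f x ≤ ‖f‖ * ‖y‖ := by
  refine supOnIcc_le f hx fun z hz => ?_
  rw [← norm_abs_eq_norm y]
  exact apply_le_of_mem_Icc f ⟨hz.1, hz.2.trans hxy⟩

theorem norm_posPartHom_le (f : StrongDual ℝ E) (x : E) : ‖posPartHom f x‖ ≤ ‖f‖ * ‖x‖ := by
  have h₁ := supOnIcc_le_norm f (posPart_nonneg x)
    (sup_le (le_abs_self x) (abs_nonneg x))
  have h₂ := supOnIcc_le_norm f (negPart_nonneg x)
    (sup_le (neg_le_abs x) (abs_nonneg x))
  have h₃ := supOnIcc_nonneg f (posPart_nonneg x)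
  have h₄ := supOnIcc_nonneg f (negPart_nonneg x)
  change |supOnIcc f x⁺ - supOnIcc f x⁻| ≤ _
  rw [abs_le]
  constructor <;> linarith

/-- The positive part of `f` in the dual: the continuous linear functional whose value at `x ≥ 0`
is `sup {f y | 0 ≤ y ≤ x}`. -/
noncomputable def dualPosPart (f : StrongDual ℝ E) : StrongDual ℝ E :=
  (posPartHom f).toRealLinearMap
    (AddMonoidHomClass.continuous_of_bound (posPartHom f) ‖f‖ (norm_posPartHom_le f))

theorem dualPosPart_apply (f : StrongDual ℝ E) {x : E} (hx : 0 ≤ x) :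
    dualPosPart f x = supOnIcc f x := by
  change supOnIcc f x⁺ - supOnIcc f x⁻ = _
  have h : supOnIcc f (0 : E) = 0 := by simp [supOnIcc]
  rw [posPart_of_nonneg hx, negPart_of_nonneg hx, h, sub_zero]

/-- The dual of a Banach lattice is a lattice for its canonical order. -/
noncomputable instance instLatticeDual : Lattice (StrongDual ℝ E) where
  sup f g := g + dualPosPart (f - g)
  inf f g := f - dualPosPart (f - g)
  le_sup_left f g := fun x hx => by
    have := le_supOnIcc (f - g) (x := x) (y := x) ⟨hx, le_rfl⟩
    simp only [add_apply, sub_apply,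
      dualPosPart_apply _ hx] at this ⊢
    linarith
  le_sup_right f g := fun x hx => by
    have := supOnIcc_nonneg (f - g) hx
    simp only [add_apply, dualPosPart_apply _ hx]
    linarith
  sup_le f g h hf hg := fun x hx => by
    have : supOnIcc (f - g) x ≤ h x - g x := supOnIcc_le _ hx fun y hy => by
      have h₁ := hf y hy.1
      have h₂ := hg (x - y) (sub_nonneg.2 hy.2)
      simp only [map_sub, sub_apply] at h₂ ⊢
      linarith
    simp only [add_apply, dualPosPart_apply _ hx]
    linarith
  inf_le_left f g := fun x hx => by
    have := supOnIcc_nonneg (f - g) hx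
    simp only [sub_apply, dualPosPart_apply _ hx]
    linarith
  inf_le_right f g := fun x hx => by
    have := le_supOnIcc (f - g) (x := x) (y := x) ⟨hx, le_rfl⟩
    simp only [sub_apply, dualPosPart_apply _ hx] at this ⊢
    linarith
  le_inf h f g hf hg := fun x hx => by
    have : supOnIcc (f - g) x ≤ f x - h x := supOnIcc_le _ hx fun y hy => by
      have h₁ := hg y hy.1
      have h₂ := hf (x - y) (sub_nonneg.2 hy.2)
      simp only [map_sub, sub_apply] at h₂ ⊢
      linarith
    simp only [sub_apply, dualPosPart_apply _ hx]
    linarith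

end Dual

/-! ### Disjoint sequences, unbounded absolute weak convergence, L-weakly compact sets -/

/-- A sequence is disjoint if its terms are pairwise lattice-disjoint: `|x m| ∧ |x n| = 0` for
`m ≠ n`. -/
def IsDisjointSeq {X : Type*} [AddCommGroup X] [Lattice X] (x : ℕ → X) : Prop :=
  Pairwise fun m n => |x m| ⊓ |x n| = 0

/-- `x` is uaw-convergent to `a`: for every `u ≥ 0`, the sequence `|x n - a| ∧ u` converges to `0`
in the weak topology of `X`. -/
def UawTendsto {X : Type*} [NormedAddCommGroup X] [NormedSpace ℝ X] [Lattice X]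
    (x : ℕ → X) (a : X) : Prop :=
  ∀ u : X, 0 ≤ u → Tendsto (fun n => toWeakSpace ℝ X (|x n - a| ⊓ u)) atTop (𝓝 0)

/-- `A` is L-weakly compact: nonempty, norm bounded, and every disjoint sequence in the solid hull
of `A` is norm null. -/
def IsLWeaklyCompact {X : Type*} [NormedAddCommGroup X] [Lattice X] (A : Set X) : Prop :=
  A.Nonempty ∧ Bornology.IsBounded A ∧
    ∀ x : ℕ → X, IsDisjointSeq x →
      (∀ n, x n ∈ LatticeOrderedAddCommGroup.solidClosure A) →
      Tendsto (fun n => ‖x n‖) atTop (𝓝 0)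

end BanachLattice

namespace BanachLattice

theorem exists_strictMono_of_frequently {P : ℕ → Prop} (hP : ∃ᶠ n in atTop, P n)
    {R : ℕ → ℕ → ℕ → Prop} (hR : ∀ k i, ∀ᶠ n in atTop, R k i n) :
    ∃ φ : ℕ → ℕ, StrictMono φ ∧ (∀ n, P (φ n)) ∧ ∀ i j, i < j → R j (φ i) (φ j) := by
  obtain ⟨f, hf, hr⟩ := exists_seq_of_forall_finset_exists (α := ℕ × ℕ) (fun a => P a.2)
    (fun a b => a.1 < b.1 ∧ a.2 < b.2 ∧ ∀ k ≤ b.1, R k a.2 b.2) (by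
      intro s _
      set l := s.sup Prod.fst + 1
      have h : ∀ᶠ n in atTop, ∀ a ∈ s, a.2 < n ∧ ∀ k ∈ Finset.range (l + 1), R k a.2 n := by
        rw [Filter.eventually_all_finset]
        intro a _
        refine (eventually_gt_atTop a.2).and ?_
        rw [Filter.eventually_all_finset]
        exact fun k _ => hR k a.2
      obtain ⟨n, hn, hn'⟩ := (hP.and_eventually h).exists
      refine ⟨(l, n), hn, fun a ha => ⟨?_, (hn' a ha).1, fun k hk => (hn' a ha).2 k ?_⟩⟩
      · exact Nat.lt_succ_of_le (Finset.le_sup (f := Prod.fst) ha)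
      · exact Finset.mem_range.2 (Nat.lt_succ_of_le hk))
  have hmono : StrictMono fun n => (f n).1 := fun i j hij => (hr i j hij).1
  exact ⟨fun n => (f n).2, fun i j hij => (hr i j hij).2.1, hf,
    fun i j hij => (hr i j hij).2.2 j (hmono.le_apply)⟩

section OrderedGroup

variable {X : Type*} [AddCommGroup X] [Lattice X] [IsOrderedAddMonoid X]

theorem inf_add_le_inf_add_inf {a b c : X} (ha : 0 ≤ a) (hb : 0 ≤ b) (hc : 0 ≤ c) :
    a ⊓ (b + c) ≤ a ⊓ b + a ⊓ c := by
  rw [add_inf, inf_add, inf_add]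
  refine le_inf (le_inf ?_ ?_) (le_inf ?_ inf_le_right)
  · exact inf_le_left.trans (le_add_of_nonneg_right ha)
  · exact inf_le_left.trans (le_add_of_nonneg_left hb)
  · exact inf_le_left.trans (le_add_of_nonneg_right hc)

theorem inf_nsmul_le_nsmul_inf {a b : X} (ha : 0 ≤ a) (hb : 0 ≤ b) (n : ℕ) :
    a ⊓ n • b ≤ n • (a ⊓ b) := by
  induction n with
  | zero => simp
  | succ n ih =>
    rw [succ_nsmul, succ_nsmul]
    exact (inf_add_le_inf_add_inf ha (nsmul_nonneg hb n) hb).trans (by gcongr)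

theorem inf_nsmul_eq_zero {a b : X} (ha : 0 ≤ a) (hb : 0 ≤ b) (h : a ⊓ b = 0) (n : ℕ) :
    a ⊓ n • b = 0 := by
  refine le_antisymm ?_ (le_inf ha (nsmul_nonneg hb n))
  simpa [h] using inf_nsmul_le_nsmul_inf ha hb n

theorem add_le_of_inf_eq_zero {a b c : X} (h : a ⊓ b = 0) (ha : a ≤ c) (hb : b ≤ c) :
    a + b ≤ c := by
  have h' := inf_add_sup a b
  rw [h, zero_add] at h'
  exact h' ▸ sup_le ha hb

theorem nsmul_inf_posPart_sub_le {a b : X} (hb : 0 ≤ b) (n : ℕ) :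
    n • (a ⊓ (b - n • a)⁺) ≤ b := by
  set p := (b - n • a)⁺ with hp
  set q := (b - n • a)⁻ with hq
  have hp0 : 0 ≤ p := posPart_nonneg _
  have hq0 : 0 ≤ q := negPart_nonneg _
  have hpq : q ⊓ p = 0 := by rw [inf_comm]; exact posPart_inf_negPart_eq_zero _
  have h₁ : n • a = b + q - p := by
    have : p - q = b - n • a := posPart_sub_negPart _
    calc n • a = b - (p - q) := by rw [this, sub_sub_cancel]
      _ = b + q - p := by abel
  calc n • (a ⊓ p) ≤ n • p ⊓ (b + q) :=
        le_inf (nsmul_le_nsmul_right inf_le_right n)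
          ((nsmul_le_nsmul_right inf_le_left n).trans (h₁ ▸ sub_le_self _ hp0))
    _ ≤ n • p ⊓ b + n • p ⊓ q := inf_add_le_inf_add_inf (nsmul_nonneg hp0 n) hb hq0
    _ = n • p ⊓ b := by
        rw [inf_comm (n • p) q, inf_nsmul_eq_zero hq0 hp0 hpq, add_zero]
    _ ≤ b := inf_le_right

theorem exists_le_of_forall_le_posPart {ι : Type*} {s : Finset ι} (hs : s.Nonempty) {a : ι → X}
    {z : X} (h : ∀ i ∈ s, z ≤ (a i)⁺) : ∃ m, (∀ i ∈ s, m ≤ a i) ∧ z ≤ m⁺ := by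
  let _ : DistribLattice X := AddCommGroup.toDistribLattice X
  refine ⟨s.inf' hs a, fun i hi => Finset.inf'_le a hi, ?_⟩
  have : (s.inf' hs a)⁺ = s.inf' hs fun i => (a i)⁺ := Finset.inf'_sup_distrib_right hs a 0
  rw [this]
  exact Finset.le_inf' hs _ h

theorem mem_of_nonneg_of_le {S : Set X}
    (hS : LatticeOrderedAddCommGroup.IsSolid S) {a b : X} (hb : b ∈ S)
    (ha : 0 ≤ a) (hab : a ≤ b) : a ∈ S :=
  hS hb (by rwa [abs_of_nonneg ha, abs_of_nonneg (ha.trans hab)])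

end OrderedGroup

section NormedLattice

variable {E : Type*} [NormedAddCommGroup E] [Lattice E] [HasSolidNorm E]

theorem isBounded_solidClosure {A : Set E} (hA : Bornology.IsBounded A) :
    Bornology.IsBounded (LatticeOrderedAddCommGroup.solidClosure A) := by
  obtain ⟨C, hC⟩ := hA.exists_norm_le
  refine isBounded_iff_forall_norm_le.2 ⟨C, ?_⟩
  rintro y ⟨x, hx, hyx⟩
  exact (norm_le_norm_of_abs_le_abs hyx).trans (hC x hx)

variable [IsOrderedAddMonoid E]

theorem norm_le_norm_of_nonneg_of_le {a b : E} (ha : 0 ≤ a) (hab : a ≤ b) : ‖a‖ ≤ ‖b‖ :=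
  norm_le_norm_of_abs_le_abs (by rwa [abs_of_nonneg ha, abs_of_nonneg (ha.trans hab)])

theorem exists_isDisjointSeq_of_norm_inf_le [CompleteSpace E] {e : ℕ → E} (he : ∀ i, 0 ≤ e i)
    {c : ℝ} (h : ∀ i j, i < j → ‖e i ⊓ e j‖ ≤ c / 2 / 2 ^ j) :
    ∃ y : ℕ → E, IsDisjointSeq y ∧ ∀ i, 0 ≤ y i ∧ y i ≤ e i ∧ ‖e i - y i‖ ≤ c := by
  classical
  set d : ℕ → ℕ → E := fun i j => if j = i then 0 else e i ⊓ e j with hd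
  have hc : 0 ≤ c := by have := (norm_nonneg _).trans (h 0 1 one_pos); linarith
  have hd0 : ∀ i j, 0 ≤ d i j := fun i j => by
    simp only [hd]; split_ifs
    exacts [le_rfl, le_inf (he i) (he j)]
  have hdn : ∀ i j, ‖d i j‖ ≤ c / 2 / 2 ^ j := fun i j => by
    simp only [hd]
    rcases lt_trichotomy i j with hij | hij | hij
    · rw [if_neg hij.ne']; exact h i j hij
    · rw [if_pos hij.symm, norm_zero]; positivity
    · rw [if_neg hij.ne, inf_comm]
      refine (h j i hij).trans ?_
      gcongr
      exact one_le_two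
  have hs : ∀ i, Summable (d i) := fun i =>
    (summable_geometric_two' c).of_norm_bounded (hdn i)
  have hsn : ∀ i, ‖∑' j, d i j‖ ≤ c := fun i =>
    tsum_of_norm_bounded (hasSum_geometric_two' c) (hdn i)
  have hle : ∀ i j, i ≠ j → (e i - ∑' j, d i j)⁺ ≤ e i - e i ⊓ e j := fun i j hij => by
    refine sup_le (sub_le_sub_left ?_ _) (sub_nonneg.2 inf_le_left)
    have := (hs i).le_tsum j fun k _ => hd0 i k
    simpa [hd, hij.symm] using this
  have hy0 : ∀ i, 0 ≤ (e i - ∑' j, d i j)⁺ := fun i => posPart_nonneg _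
  refine ⟨fun i => (e i - ∑' j, d i j)⁺, fun i j hij => ?_, fun i => ⟨hy0 i, ?_, ?_⟩⟩
  · dsimp only
    rw [abs_of_nonneg (hy0 i), abs_of_nonneg (hy0 j)]
    refine le_antisymm ?_ (le_inf (hy0 i) (hy0 j))
    refine (inf_le_inf (hle i j hij) (hle j i hij.symm)).trans ?_
    rw [inf_comm (e j), ← inf_sub, sub_self]
  · exact sup_le (sub_le_self _ (tsum_nonneg (hd0 i))) (he i)
  · refine le_trans ?_ (hsn i)
    have := norm_sup_sub_sup_le_norm (e i) (e i - ∑' j, d i j) 0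
    rwa [sub_sub_cancel, sup_of_le_left (he i)] at this

variable {S : Set E}

/-- Every disjoint sequence in `S` is norm null. -/
def DisjointNull (S : Set E) : Prop :=
  ∀ x : ℕ → E, IsDisjointSeq x → (∀ n, x n ∈ S) → Tendsto (fun n => ‖x n‖) atTop (𝓝 0)

theorem frequently_le_of_not_tendsto_zero {u : ℕ → ℝ} (hu : ∀ n, 0 ≤ u n)
    (h : ¬ Tendsto u atTop (𝓝 0)) : ∃ ε > 0, ∃ᶠ n in atTop, ε ≤ u n := by
  by_contra! H
  refine h (tendsto_order.2 ⟨fun a ha => Eventually.of_forall fun n => ha.trans_le (hu n),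
    fun ε hε => ?_⟩)
  simpa using H ε hε

variable [CompleteSpace E]

theorem DisjointNull.tendsto_of_tendsto_inf (hd : DisjointNull S)
    (hS : LatticeOrderedAddCommGroup.IsSolid S) {e : ℕ → E} (he : ∀ i, 0 ≤ e i)
    (heS : ∀ i, e i ∈ S) (h : ∀ i, Tendsto (fun j => ‖e i ⊓ e j‖) atTop (𝓝 0)) :
    Tendsto (fun n => ‖e n‖) atTop (𝓝 0) := by
  by_contra hnot
  obtain ⟨ε, hε, hfr⟩ := frequently_le_of_not_tendsto_zero (fun n => norm_nonneg (e n)) hnot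
  obtain ⟨φ, -, hφ, hR⟩ := exists_strictMono_of_frequently hfr
    (R := fun k i n => ‖e i ⊓ e n‖ ≤ ε / 2 / 2 / 2 ^ k)
    (fun k i => (h i).eventually_le_const (by positivity))
  obtain ⟨y, hy, hye⟩ := exists_isDisjointSeq_of_norm_inf_le (fun i => he (φ i)) hR
  have hlim := hd y hy fun n => mem_of_nonneg_of_le hS (heS (φ n)) (hye n).1 (hye n).2.1
  obtain ⟨n, hn⟩ := (hlim.eventually_lt_const (half_pos hε)).exists
  have h₁ := hφ n
  have h₂ := norm_le_norm_add_norm_sub' (e (φ n)) (y n)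
  have h₃ := (hye n).2.2
  linarith

theorem DisjointNull.tendsto_of_multiplicity (hd : DisjointNull S)
    (hS : LatticeOrderedAddCommGroup.IsSolid S) (N : ℕ) {e : ℕ → E} (he : ∀ i, 0 ≤ e i)
    (heS : ∀ i, e i ∈ S)
    (h : ∀ s : Finset ℕ, s.card = N + 1 → ∀ z, 0 ≤ z → (∀ i ∈ s, z ≤ e i) → z = 0) :
    Tendsto (fun n => ‖e n‖) atTop (𝓝 0) := by
  induction N generalizing e with
  | zero =>
    have : ∀ n, e n = 0 := fun n => h {n} rfl _ (he n) (by simp)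
    simp [this]
  | succ N ih =>
    refine hd.tendsto_of_tendsto_inf hS he heS fun i => ?_
    rw [← tendsto_add_atTop_iff_nat (i + 1)]
    refine ih (fun j => le_inf (he _) (he _))
      (fun j => mem_of_nonneg_of_le hS (heS i) (le_inf (he _) (he _)) inf_le_left) ?_
    intro s hs z hz hzs
    have hi : i ∉ s.map (addRightEmbedding (i + 1)) := by
      simp only [Finset.mem_map, addRightEmbedding_apply, not_exists, not_and]
      intro j _; omega
    refine h (insert i (s.map (addRightEmbedding (i + 1)))) ?_ z hz ?_
    · rw [Finset.card_insert_of_notMem hi, Finset.card_map, hs]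
    · obtain ⟨j, hj⟩ : s.Nonempty := Finset.card_pos.1 (by omega)
      simp only [Finset.mem_insert, Finset.mem_map, addRightEmbedding_apply]
      rintro _ (rfl | ⟨k, hk, rfl⟩)
      · exact (hzs j hj).trans inf_le_left
      · exact (hzs k hk).trans inf_le_right

variable [NormedSpace ℝ E] [IsOrderedModule ℝ E]

theorem DisjointNull.tendsto_of_sum_le (hd : DisjointNull S)
    (hS : LatticeOrderedAddCommGroup.IsSolid S) {x : E} (hx : x ∈ S) {d : ℕ → E}
    (hd0 : ∀ i, 0 ≤ d i) (h : ∀ n, ∑ i ∈ Finset.range n, d i ≤ x) :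
    Tendsto (fun n => ‖d n‖) atTop (𝓝 0) := by
  have hx0 : 0 ≤ x := by simpa using h 0
  have hsum : ∀ s : Finset ℕ, ∑ i ∈ s, d i ≤ x := fun s => by
    obtain ⟨n, hn⟩ := s.exists_nat_subset_range
    exact (Finset.sum_le_sum_of_subset_of_nonneg hn fun i _ _ => hd0 i).trans (h n)
  have hdx : ∀ i, d i ≤ x := fun i => by simpa using hsum {i}
  have key : ∀ N : ℕ,
      Tendsto (fun n => ‖(d n - ((N + 1 : ℕ) : ℝ)⁻¹ • x)⁺‖) atTop (𝓝 0) := fun N => by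
    have hNx : 0 ≤ ((N + 1 : ℕ) : ℝ)⁻¹ • x := smul_nonneg (by positivity) hx0
    refine hd.tendsto_of_multiplicity hS N (fun i => posPart_nonneg _)
      (fun i => mem_of_nonneg_of_le hS hx (posPart_nonneg _)
        (sup_le ((sub_le_self _ hNx).trans (hdx i)) hx0)) ?_
    intro s hs z hz hzs
    obtain ⟨m, hm, hzm⟩ := exists_le_of_forall_le_posPart (Finset.card_pos.1 (by omega)) hzs
    have h₁ : (N + 1) • (m + ((N + 1 : ℕ) : ℝ)⁻¹ • x) ≤ x := by
      rw [← hs]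
      exact (Finset.card_nsmul_le_sum s d _ fun i hi =>
        le_sub_iff_add_le.1 (hs ▸ hm i hi)).trans (hsum s)
    rw [← Nat.cast_smul_eq_nsmul ℝ, smul_add, smul_inv_smul₀ (by positivity),
      add_le_iff_nonpos_left] at h₁
    have h₂ : m ≤ 0 := by
      have := smul_nonneg (α := ℝ) (a := ((N + 1 : ℕ) : ℝ)⁻¹) (by positivity) (neg_nonneg.2 h₁)
      rw [smul_neg, inv_smul_smul₀ (by positivity)] at this
      exact neg_nonneg.1 this
    rw [posPart_of_nonpos h₂] at hzm
    exact le_antisymm hzm hz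
  by_contra hnot
  obtain ⟨ε, hε, hfr⟩ := frequently_le_of_not_tendsto_zero (fun n => norm_nonneg (d n)) hnot
  have hN : Tendsto (fun N : ℕ => ((N + 1 : ℕ) : ℝ)⁻¹ * ‖x‖) atTop (𝓝 0) := by
    have := ((tendsto_add_atTop_iff_nat 1).2 (tendsto_inv_atTop_nhds_zero_nat (𝕜 := ℝ))).mul_const
      ‖x‖
    rwa [zero_mul] at this
  obtain ⟨N, hN⟩ := (hN.eventually_lt_const (half_pos hε)).exists
  obtain ⟨n, hn, hn'⟩ := (hfr.and_eventually ((key N).eventually_lt_const (half_pos hε))).exists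
  have h₁ := norm_sup_sub_sup_le_norm (d n) (d n - ((N + 1 : ℕ) : ℝ)⁻¹ • x) 0
  rw [sub_sub_cancel, sup_of_le_left (hd0 n), norm_smul, Real.norm_of_nonneg (by positivity)] at h₁
  have h₂ := norm_le_norm_add_norm_sub' (d n) (d n - ((N + 1 : ℕ) : ℝ)⁻¹ • x)⁺
  rw [posPart_def] at h₂ hn'
  linarith

theorem DisjointNull.exists_tendsto_of_antitone (hd : DisjointNull S)
    (hS : LatticeOrderedAddCommGroup.IsSolid S) {v : ℕ → E} (hv : Antitone v)
    (hv0 : ∀ n, 0 ≤ v n) (hvS : v 0 ∈ S) : ∃ a, Tendsto v atTop (𝓝 a) := by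
  refine cauchySeq_tendsto_of_complete (Metric.cauchySeq_iff'.2 ?_)
  by_contra! H
  obtain ⟨ε, hε, H⟩ := H
  choose g hg hgd using H
  set φ : ℕ → ℕ := fun n => g^[n] 0 with hφ
  have hsucc : ∀ n, φ (n + 1) = g (φ n) := fun n => Function.iterate_succ_apply' g n 0
  have hlim := hd.tendsto_of_sum_le hS hvS (d := fun n => v (φ n) - v (φ (n + 1)))
    (fun n => sub_nonneg.2 (hv (hsucc n ▸ hg _)))
    (fun n => by
      rw [Finset.sum_range_sub' (fun n => v (φ n))]
      exact sub_le_self _ (hv0 _))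
  obtain ⟨n, hn⟩ := (hlim.eventually_lt_const hε).exists
  have := hgd (φ n)
  rw [dist_comm, dist_eq_norm, ← hsucc] at this
  linarith

theorem DisjointNull.exists_lower_bound (hd : DisjointNull S)
    (hS : LatticeOrderedAddCommGroup.IsSolid S) {F : StrongDual ℝ E} (hF : ∀ y, 0 ≤ y → 0 ≤ F y)
    {x : E} (hx : x ∈ S) {u : ℕ → E} (hu : ∀ m, u m ∈ Icc 0 x) {δ : ℝ}
    (hFu : ∀ m, F (x - u m) ≤ δ / 2 / 2 ^ m) :
    ∃ v ∈ Icc 0 x, (∀ m, v ≤ u m) ∧ F (x - v) ≤ δ := by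
  have hx0 : 0 ≤ x := (hu 0).1.trans (hu 0).2
  set V : ℕ → E := fun n => Nat.rec x (fun m a => a ⊓ u m) n with hV
  have hVs : ∀ n, V (n + 1) = V n ⊓ u n := fun n => rfl
  have hVa : Antitone V := antitone_nat_of_succ_le fun n => hVs n ▸ inf_le_left
  have hV0 : ∀ n, 0 ≤ V n := fun n => by
    induction n with
    | zero => exact hx0
    | succ n ih => exact le_inf ih (hu n).1
  have hFV : ∀ n, F (x - V n) ≤ ∑ m ∈ Finset.range n, δ / 2 / 2 ^ m := fun n => by
    induction n with
    | zero => simp [hV]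
    | succ n ih =>
      rw [Finset.sum_range_succ]
      refine le_trans ?_ (add_le_add ih (hFu n))
      rw [← map_add, ← sub_nonneg, ← map_sub]
      apply hF
      rw [hVs]
      have h₁ : x - V n ⊓ u n ≤ x - V n + (x - u n) := by
        rw [sub_le_comm]
        refine le_inf ?_ ?_
        · rw [sub_le_comm]; exact le_add_of_nonneg_right (sub_nonneg.2 (hu n).2)
        · rw [sub_le_comm]
          exact le_add_of_nonneg_left (sub_nonneg.2 (hVa (Nat.zero_le n)))
      exact sub_nonneg.2 h₁
  have hδ : 0 ≤ δ := by
    have := (hF _ (sub_nonneg.2 (hu 0).2)).trans (hFu 0)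
    simp only [pow_zero, div_one] at this
    linarith
  obtain ⟨v, hv⟩ := hd.exists_tendsto_of_antitone hS hVa hV0 hx
  have hvV : ∀ n, v ≤ V n := fun n => hVa.le_of_tendsto hv n
  refine ⟨v, ⟨ge_of_tendsto' hv hV0, hvV 0⟩, fun m => (hvV (m + 1)).trans inf_le_right, ?_⟩
  refine le_of_tendsto' ((F.continuous.tendsto _).comp (tendsto_const_nhds.sub hv)) fun n => ?_
  refine (hFV n).trans ?_
  exact sum_le_hasSum _ (fun m _ => by positivity) (hasSum_geometric_two' δ)

end NormedLattice

theorem tendsto_toWeakSpace_zero_iff {X : Type*} [NormedAddCommGroup X] [NormedSpace ℝ X]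
    {u : ℕ → X} : Tendsto (fun n => toWeakSpace ℝ X (u n)) atTop (𝓝 0) ↔
      ∀ F : StrongDual ℝ X, Tendsto (fun n => F (u n)) atTop (𝓝 0) := by
  have hB : Function.Injective (topDualPairing ℝ X).flip := fun x y h =>
    SeparatingDual.eq_iff_forall_dual_eq (R := ℝ).2 fun F => congrArg (fun k => k F) h
  have h := WeakBilin.tendsto_iff_forall_eval_tendsto (l := atTop) (f := u) (x := (0 : X)) _ hB
  simp only [LinearMap.flip_apply, map_zero] at h
  exact h

section OrderedGroup

variable {X : Type*} [AddCommGroup X] [Lattice X] [IsOrderedAddMonoid X]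

theorem sum_le_of_pairwise_inf_eq_zero {ι : Type*} {s : Finset ι} {a : ι → X} {x : X}
    (hx : 0 ≤ x) (ha : ∀ i, 0 ≤ a i) (hax : ∀ i, a i ≤ x)
    (h : Pairwise fun i j => a i ⊓ a j = 0) : ∑ i ∈ s, a i ≤ x := by
  classical
  have key : ∀ (t : Finset ι) (i : ι), i ∉ t → a i ⊓ ∑ j ∈ t, a j = 0 := fun t i => by
    induction t using Finset.induction_on with
    | empty => intro _; simpa using ha i
    | insert j t hj ih =>
      intro hi
      rw [Finset.mem_insert, not_or] at hi
      rw [Finset.sum_insert hj]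
      have h0 : 0 ≤ ∑ j ∈ t, a j := Finset.sum_nonneg fun k _ => ha k
      refine le_antisymm ((inf_add_le_inf_add_inf (ha i) (ha j) h0).trans ?_)
        (le_inf (ha i) (add_nonneg (ha j) h0))
      rw [h hi.1, ih hi.2, add_zero]
  induction s using Finset.induction_on with
  | empty => simpa using hx
  | insert j t hj ih =>
    rw [Finset.sum_insert hj]
    exact add_le_of_inf_eq_zero (key t j hj) (hax j) ih

theorem pairwise_inf_nsmul_inf_eq_zero {y : ℕ → X} (hy : IsDisjointSeq y) (hy0 : ∀ n, 0 ≤ y n)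
    {x : X} (hx : 0 ≤ x) (m : ℕ) :
    Pairwise fun i j => (x ⊓ m • y i) ⊓ (x ⊓ m • y j) = 0 := fun i j hij => by
  have h : y i ⊓ y j = 0 := by simpa [abs_of_nonneg, hy0] using hy hij
  have h₁ : m • y i ⊓ m • y j = 0 := by
    refine inf_nsmul_eq_zero (nsmul_nonneg (hy0 i) m) (hy0 j) ?_ m
    rw [inf_comm] at h ⊢
    exact inf_nsmul_eq_zero (hy0 j) (hy0 i) h m
  have hn := fun k => le_inf hx (nsmul_nonneg (hy0 k) m)
  exact le_antisymm (h₁ ▸ inf_le_inf inf_le_right inf_le_right) (le_inf (hn i) (hn j))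

end OrderedGroup

variable {E : Type*} [NormedAddCommGroup E] [NormedSpace ℝ E] [Lattice E]
  [IsOrderedAddMonoid E]

theorem apply_le_apply_of_le {f : StrongDual ℝ E} (hf : 0 ≤ f) {x y : E} (h : x ≤ y) :
    f x ≤ f y := by
  rw [← sub_nonneg, ← map_sub]
  exact hf _ (sub_nonneg.2 h)

theorem apply_nonneg {f : StrongDual ℝ E} (hf : 0 ≤ f) {x : E} (h : 0 ≤ x) : 0 ≤ f x :=
  hf x h

theorem abs_apply_le_apply_abs {f : StrongDual ℝ E} (hf : 0 ≤ f) (x : E) : |f x| ≤ f |x| :=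
  abs_le'.2 ⟨apply_le_apply_of_le hf (le_abs_self x),
    by rw [← map_neg]; exact apply_le_apply_of_le hf (neg_le_abs x)⟩

variable [HasSolidNorm E]

instance instIsOrderedAddMonoidDual : IsOrderedAddMonoid (StrongDual ℝ E) where
  add_le_add_left f g h k := fun x hx => by
    simpa using h x hx

theorem abs_apply_le_abs_apply (f : StrongDual ℝ E) {x : E} (hx : 0 ≤ x) : |f x| ≤ |f| x :=
  abs_le'.2 ⟨le_abs_self f x hx, neg_le_abs f x hx⟩

theorem norm_dualPosPart_le (f : StrongDual ℝ E) : ‖dualPosPart f‖ ≤ ‖f‖ :=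
  ContinuousLinearMap.opNorm_le_bound _ (norm_nonneg f) (norm_posPartHom_le f)

theorem norm_abs_dual_le (f : StrongDual ℝ E) : ‖|f|‖ ≤ 3 * ‖f‖ := by
  have h : |f| = -f + dualPosPart (f - -f) := rfl
  have h₁ := norm_add_le (-f) (dualPosPart (f - -f))
  have h₂ := norm_dualPosPart_le (f - -f)
  have h₃ := norm_sub_le f (-f)
  rw [norm_neg] at h₁ h₃
  rw [h]
  linarith

theorem exists_mem_Icc_of_inf_apply_lt {f g : StrongDual ℝ E} {x : E} (hx : 0 ≤ x) {δ : ℝ}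
    (h : (f ⊓ g) x < δ) : ∃ u ∈ Icc 0 x, f u + g (x - u) < δ := by
  have h' : f x - supOnIcc (f - g) x < δ := by rw [← dualPosPart_apply _ hx]; exact h
  obtain ⟨_, ⟨y, hy, rfl⟩, hlt⟩ := exists_lt_of_lt_csSup
    (⟨_, 0, ⟨le_rfl, hx⟩, rfl⟩ : ((f - g) '' Icc 0 x).Nonempty) (sub_lt_comm.1 h')
  refine ⟨x - y, ⟨sub_nonneg.2 hy.2, sub_le_self _ hy.1⟩, ?_⟩
  rw [sub_sub_cancel, map_sub]
  rw [sub_apply] at hlt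
  linarith

section Necessity

variable [CompleteSpace E] [IsOrderedModule ℝ E] {S : Set E}

theorem DisjointNull.exists_almost_separated (hd : DisjointNull S)
    (hS : LatticeOrderedAddCommGroup.IsSolid S) {G : ℕ → StrongDual ℝ E} (hG : ∀ n, 0 ≤ G n)
    {x : ℕ → E} (hx : ∀ n, 0 ≤ x n) (hxS : ∀ n, x n ∈ S) {δ : ℝ} (hδ : 0 < δ)
    (h : ∀ i j, i < j → (G j ⊓ G i) (x i) < δ / 4 ^ j) :
    ∃ v : ℕ → E, (∀ i, v i ∈ Icc 0 (x i)) ∧ (∀ i, G i (x i - v i) ≤ δ) ∧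
      ∀ i j, i < j → G j (v i) ≤ δ / 4 ^ j := by
  have key : ∀ i, ∃ v ∈ Icc 0 (x i), G i (x i - v) ≤ δ ∧ ∀ j, i < j → G j v ≤ δ / 4 ^ j := by
    intro i
    choose u hu hGu using fun m : ℕ =>
      exists_mem_Icc_of_inf_apply_lt (hx i) (h i (i + 1 + m) (by omega))
    obtain ⟨v, hv, hvu, hGv⟩ := hd.exists_lower_bound hS (fun y hy => apply_nonneg (hG i) hy)
      (hxS i) hu (δ := δ) (fun m => by
        have h₁ := apply_nonneg (hG (i + 1 + m)) (hu m).1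
        have h₂ : δ / 4 ^ (i + 1 + m) ≤ δ / 2 / 2 ^ m := by
          rw [div_div]
          gcongr
          calc (2 : ℝ) * 2 ^ m = 2 ^ (m + 1) := by ring
            _ ≤ 4 ^ (m + 1) := by gcongr; norm_num
            _ ≤ 4 ^ (i + 1 + m) := by
              apply pow_le_pow_right₀ (by norm_num); omega
        linarith [hGu m])
    refine ⟨v, hv, hGv, fun j hij => ?_⟩
    obtain ⟨m, rfl⟩ := Nat.exists_eq_add_of_le hij
    have h₁ := apply_nonneg (hG i) (sub_nonneg.2 (hu m).2)
    have h₂ := apply_le_apply_of_le (hG (i + 1 + m)) (hvu m)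
    have h₃ := hGu m
    exact (by linarith : G (i + 1 + m) v ≤ δ / 4 ^ (i + 1 + m))
  choose v hv hv' hv'' using key
  exact ⟨v, hv, hv', hv''⟩

theorem DisjointNull.exists_small_of_almost_separated (hd : DisjointNull S)
    (hS : LatticeOrderedAddCommGroup.IsSolid S) (hb : Bornology.IsBounded S)
    {G : ℕ → StrongDual ℝ E} (hG : ∀ n, 0 ≤ G n) {M : ℝ} (hM : ∀ n, ‖G n‖ ≤ M) {v : ℕ → E}
    (hv : ∀ n, 0 ≤ v n) (hvS : ∀ n, v n ∈ S) {δ : ℝ} (hδ : 0 < δ)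
    (h : ∀ i j, i < j → G j (v i) ≤ δ / 4 ^ j) : ∃ n, G n (v n) ≤ 2 * δ := by
  obtain ⟨K, hK⟩ := hb.exists_norm_le
  set z : ℕ → E := fun k => (v k - 2 ^ k • ∑ i ∈ Finset.range k, v i)⁺ with hz
  have hs0 : ∀ k, 0 ≤ ∑ i ∈ Finset.range k, v i := fun k => Finset.sum_nonneg fun i _ => hv i
  have hz0 : ∀ k, 0 ≤ z k := fun k => posPart_nonneg _
  have hzv : ∀ k, z k ≤ v k := fun k => sup_le (sub_le_self _ (nsmul_nonneg (hs0 k) _)) (hv k)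
  have hinf : ∀ i j, i < j → ‖z i ⊓ z j‖ ≤ K / 2 ^ j := fun i j hij => by
    have h₁ : z j ≤ (v j - 2 ^ j • v i)⁺ := posPart_mono (sub_le_sub_left
      (nsmul_le_nsmul_right (Finset.single_le_sum (fun k _ => hv k) (Finset.mem_range.2 hij)) _) _)
    have h₂ : 2 ^ j • (z i ⊓ z j) ≤ v j :=
      (nsmul_le_nsmul_right (inf_le_inf (hzv i) h₁) _).trans
        (nsmul_inf_posPart_sub_le (hv j) _)
    have h₃ := (norm_le_norm_of_nonneg_of_le
      (nsmul_nonneg (le_inf (hz0 i) (hz0 j)) _) h₂).trans (hK _ (hvS j))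
    rw [← Nat.cast_smul_eq_nsmul ℝ, norm_smul] at h₃
    rw [le_div_iff₀' (by positivity)]
    simpa using h₃
  have hlim := hd.tendsto_of_tendsto_inf hS hz0
    (fun n => mem_of_nonneg_of_le hS (hvS n) (hz0 n) (hzv n)) fun i => by
      refine squeeze_zero' (Eventually.of_forall fun _ => norm_nonneg _)
        ((eventually_gt_atTop i).mono fun j hj => hinf i j hj) ?_
      simpa [div_eq_mul_inv] using
        (tendsto_pow_atTop_nhds_zero_of_lt_one (r := (2 : ℝ)⁻¹) (by norm_num)
          (by norm_num)).const_mul K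
  have hlim' := hlim.const_mul M
  rw [mul_zero] at hlim'
  obtain ⟨k, hk⟩ := (hlim'.eventually_lt_const hδ).exists
  refine ⟨k, ?_⟩
  have h₁ : G k (v k) - 2 ^ k * ∑ i ∈ Finset.range k, G k (v i) ≤ G k (z k) := by
    have := apply_le_apply_of_le (hG k) (le_posPart (v k - 2 ^ k • ∑ i ∈ Finset.range k, v i))
    simpa [map_sub, map_nsmul, map_sum] using this
  have h₂ : G k (z k) ≤ M * ‖z k‖ :=
    (Real.le_norm_self _).trans ((G k).le_of_opNorm_le (hM k) _)
  have h₃ : ∑ i ∈ Finset.range k, G k (v i) ≤ 2 ^ k * (δ / 4 ^ k) := by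
    calc ∑ i ∈ Finset.range k, G k (v i) ≤ ∑ i ∈ Finset.range k, δ / 4 ^ k :=
          Finset.sum_le_sum fun i hi => h i k (Finset.mem_range.1 hi)
      _ = k * (δ / 4 ^ k) := by simp
      _ ≤ 2 ^ k * (δ / 4 ^ k) := by
          gcongr
          exact_mod_cast Nat.lt_two_pow_self.le
  have h₄ : (2 : ℝ) ^ k * (2 ^ k * (δ / 4 ^ k)) = δ := by
    rw [← mul_assoc, ← mul_pow]
    norm_num
    field_simp
  have h₅ := mul_le_mul_of_nonneg_left h₃ (by positivity : (0 : ℝ) ≤ 2 ^ k)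
  linarith

theorem DisjointNull.tendsto_apply_of_uawTendsto (hd : DisjointNull S)
    (hS : LatticeOrderedAddCommGroup.IsSolid S) (hb : Bornology.IsBounded S)
    {f : ℕ → StrongDual ℝ E} (hf : Bornology.IsBounded (range f)) (hf0 : UawTendsto f 0)
    {x : ℕ → E} (hx : ∀ n, 0 ≤ x n) (hxS : ∀ n, x n ∈ S) :
    Tendsto (fun n => f n (x n)) atTop (𝓝 0) := by
  rw [tendsto_zero_iff_abs_tendsto_zero]
  simp only [Function.comp_def]
  obtain ⟨M, hM⟩ := hf.exists_norm_le
  have hM' : ∀ n, ‖|f n|‖ ≤ 3 * M := fun n =>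
    (norm_abs_dual_le _).trans (by linarith [hM _ (mem_range_self n)])
  by_contra hnot
  obtain ⟨ε, hε, hfr⟩ := frequently_le_of_not_tendsto_zero (fun n => abs_nonneg (f n (x n))) hnot
  obtain ⟨φ, -, hφ, hR⟩ := exists_strictMono_of_frequently hfr
    (R := fun k i n => (|f n| ⊓ |f i|) (x i) < ε / 4 / 4 ^ k) (fun k i => by
      have := tendsto_toWeakSpace_zero_iff.1 (hf0 |f i| (abs_nonneg _))
        (NormedSpace.inclusionInDoubleDual ℝ E (x i))
      simp only [sub_zero, NormedSpace.dual_def] at this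
      exact this.eventually_lt_const (by positivity))
  obtain ⟨v, hv, hv', hv''⟩ := hd.exists_almost_separated hS (fun n => abs_nonneg (f (φ n)))
    (fun n => hx (φ n)) (fun n => hxS (φ n)) (by positivity) hR
  obtain ⟨n, hn⟩ := hd.exists_small_of_almost_separated hS hb (fun n => abs_nonneg (f (φ n)))
    (fun n => hM' (φ n)) (fun n => (hv n).1)
    (fun n => mem_of_nonneg_of_le hS (hxS (φ n)) (hv n).1 (hv n).2) (by positivity) hv''
  have h₁ := hφ n
  have h₂ := abs_apply_le_abs_apply (f (φ n)) (hx (φ n))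
  have h₃ := hv' n
  rw [map_sub] at h₃
  linarith

end Necessity

section Sufficiency

theorem exists_dual_of_additive_on_nonneg {q : E → ℝ} {C : ℝ}
    (hadd : ∀ a b, 0 ≤ a → 0 ≤ b → q (a + b) = q a + q b) (h0 : ∀ a, 0 ≤ a → 0 ≤ q a)
    (hC : ∀ a, 0 ≤ a → q a ≤ C * ‖a‖) : ∃ g : StrongDual ℝ E, ∀ x, 0 ≤ x → g x = q x := by
  have hsub : ∀ a b c d : E, 0 ≤ a → 0 ≤ b → 0 ≤ c → 0 ≤ d → a - b = c - d →
      q a - q b = q c - q d := fun a b c d ha hb hc hd h => by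
    have := congrArg q (sub_eq_sub_iff_add_eq_add.1 h)
    rw [hadd a d ha hd, hadd c b hc hb] at this
    linarith
  have hq0 : q 0 = 0 := by simpa using hadd 0 0 le_rfl le_rfl
  let g₀ : E →+ ℝ :=
    { toFun := fun x => q x⁺ - q x⁻
      map_zero' := by simp
      map_add' := fun x y => by
        rw [hsub _ _ (x⁺ + y⁺) (x⁻ + y⁻) (posPart_nonneg _) (negPart_nonneg _)
          (add_nonneg (posPart_nonneg x) (posPart_nonneg y))
          (add_nonneg (negPart_nonneg x) (negPart_nonneg y)),
          hadd _ _ (posPart_nonneg x) (posPart_nonneg y),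
          hadd _ _ (negPart_nonneg x) (negPart_nonneg y)]
        · ring
        · rw [posPart_sub_negPart, add_sub_add_comm, posPart_sub_negPart, posPart_sub_negPart] }
  have hbound : ∀ x, ‖g₀ x‖ ≤ C * ‖x‖ := fun x => by
    have h₁ := hC |x| (abs_nonneg x)
    rw [← posPart_add_negPart x, hadd _ _ (posPart_nonneg x) (negPart_nonneg x),
      posPart_add_negPart, norm_abs_eq_norm] at h₁
    have h₂ := h0 _ (posPart_nonneg x)
    have h₃ := h0 _ (negPart_nonneg x)
    change |q x⁺ - q x⁻| ≤ _
    rw [abs_le]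
    constructor <;> linarith
  refine ⟨g₀.toRealLinearMap (AddMonoidHomClass.continuous_of_bound g₀ C hbound), fun x hx => ?_⟩
  change q x⁺ - q x⁻ = q x
  rw [posPart_of_nonneg hx, negPart_of_nonneg hx, hq0, sub_zero]

/-- A functional is carried by `y ≥ 0` if it is determined by its values on the ideal generated
by `y`: `f (x - x ∧ m y) → 0` as `m → ∞`, for every `x ≥ 0`. -/
def IsCarriedBy (f : StrongDual ℝ E) (y : E) : Prop :=
  ∀ x, 0 ≤ x → Tendsto (fun m : ℕ => f (x - x ⊓ m • y)) atTop (𝓝 0)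

theorem exists_isCarriedBy_of_nonneg {f : StrongDual ℝ E} (hf : 0 ≤ f) {y : E} (hy : 0 ≤ y) :
    ∃ g : StrongDual ℝ E, 0 ≤ g ∧ g ≤ f ∧ g y = f y ∧ IsCarriedBy g y := by
  have hmono : ∀ x, Monotone fun m : ℕ => f (x ⊓ m • y) := fun x m n hmn =>
    apply_le_apply_of_le hf (inf_le_inf_left x (nsmul_le_nsmul_left hy hmn))
  have hle : ∀ x (m : ℕ), f (x ⊓ m • y) ≤ f x := fun x m => apply_le_apply_of_le hf inf_le_left
  have hbdd : ∀ x, BddAbove (range fun m : ℕ => f (x ⊓ m • y)) := fun x =>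
    ⟨f x, by rintro _ ⟨m, rfl⟩; exact hle x m⟩
  set q : E → ℝ := fun x => ⨆ m : ℕ, f (x ⊓ m • y) with hq
  have hlim : ∀ x, Tendsto (fun m : ℕ => f (x ⊓ m • y)) atTop (𝓝 (q x)) := fun x =>
    tendsto_atTop_ciSup (hmono x) (hbdd x)
  have hqle : ∀ x, q x ≤ f x := fun x => ciSup_le (hle x)
  have hleq : ∀ x (m : ℕ), f (x ⊓ m • y) ≤ q x := fun x m => le_ciSup (hbdd x) m
  have hq0 : ∀ x, 0 ≤ x → 0 ≤ q x := fun x hx => by simpa [hx] using hleq x 0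
  have hadd : ∀ a b, 0 ≤ a → 0 ≤ b → q (a + b) = q a + q b := fun a b ha hb => by
    refine le_antisymm (le_of_tendsto_of_tendsto' (hlim _) ((hlim a).add (hlim b)) fun m => ?_)
      (le_of_tendsto' ((hlim a).add (hlim b)) fun m => ?_)
    · rw [← map_add]
      refine apply_le_apply_of_le hf ?_
      have := inf_add_le_inf_add_inf (nsmul_nonneg hy m) ha hb
      rwa [inf_comm, inf_comm _ a, inf_comm _ b] at this
    · rw [← map_add]
      refine le_trans (apply_le_apply_of_le hf ?_) (hleq (a + b) (m + m))
      rw [add_nsmul]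
      exact le_inf (add_le_add inf_le_left inf_le_left) (add_le_add inf_le_right inf_le_right)
  obtain ⟨g, hg⟩ := exists_dual_of_additive_on_nonneg hadd hq0 (C := ‖f‖) fun a ha =>
    (hqle a).trans ((Real.le_norm_self _).trans (f.le_opNorm a))
  have hg' : ∀ x, 0 ≤ x → ∀ m : ℕ, f (x ⊓ m • y) ≤ g (x ⊓ m • y) := fun x hx m => by
    rw [hg _ (le_inf hx (nsmul_nonneg hy m))]
    simpa [inf_assoc] using hleq (x ⊓ m • y) m
  refine ⟨g, fun x hx => ?_, fun x hx => ?_, ?_, fun x hx => ?_⟩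
  · rw [hg x hx]; exact hq0 x hx
  · rw [hg x hx]; exact hqle x
  · rw [hg y hy]
    exact le_antisymm (hqle y) (by simpa using hleq y 1)
  · refine squeeze_zero (fun m => ?_) (fun m => ?_) (g := fun m : ℕ => q x - f (x ⊓ m • y)) ?_
    · rw [hg _ (sub_nonneg.2 inf_le_left)]
      exact hq0 _ (sub_nonneg.2 inf_le_left)
    · rw [map_sub, hg x hx]
      exact sub_le_sub_left (hg' x hx m) _
    · simpa using (hlim x).const_sub (q x)

theorem IsCarriedBy.mono {f g : StrongDual ℝ E} {y : E} (hg : IsCarriedBy g y) (hf : 0 ≤ f)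
    (hfg : f ≤ g) : IsCarriedBy f y := fun x hx =>
  squeeze_zero (fun _ => apply_nonneg hf (sub_nonneg.2 inf_le_left))
    (fun _ => hfg _ (sub_nonneg.2 inf_le_left)) (hg x hx)

theorem sum_apply_le_of_isCarriedBy {y : ℕ → E} (hy : IsDisjointSeq y) (hy0 : ∀ n, 0 ≤ y n)
    {h : ℕ → StrongDual ℝ E} {u : StrongDual ℝ E} (hhu : ∀ n, h n ≤ u)
    (hu : 0 ≤ u) (hc : ∀ n, IsCarriedBy (h n) (y n)) (s : Finset ℕ) {x : E} (hx : 0 ≤ x) :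
    ∑ n ∈ s, h n x ≤ u x := by
  have hlim : Tendsto (fun m : ℕ => ∑ n ∈ s, h n (x ⊓ m • y n)) atTop (𝓝 (∑ n ∈ s, h n x)) := by
    refine tendsto_finsetSum _ fun n _ => ?_
    simpa using (hc n x hx).const_sub (h n x)
  refine le_of_tendsto' hlim fun m => ?_
  have hn := fun n => le_inf hx (nsmul_nonneg (hy0 n) m)
  calc ∑ n ∈ s, h n (x ⊓ m • y n) ≤ ∑ n ∈ s, u (x ⊓ m • y n) :=
        Finset.sum_le_sum fun n _ => hhu n _ (hn n)
    _ = u (∑ n ∈ s, x ⊓ m • y n) := (map_sum u _ s).symm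
    _ ≤ u x := apply_le_apply_of_le hu (sum_le_of_pairwise_inf_eq_zero hx hn
        (fun _ => inf_le_left) (pairwise_inf_nsmul_inf_eq_zero hy hy0 hx m))

theorem tendsto_dual_apply_of_sum_apply_le {h : ℕ → StrongDual ℝ E} {u : StrongDual ℝ E}
    (hh : ∀ n, 0 ≤ h n) (hsum : ∀ (s : Finset ℕ) (x : E), 0 ≤ x → ∑ n ∈ s, h n x ≤ u x)
    (F : StrongDual ℝ (StrongDual ℝ E)) : Tendsto (fun n => F (h n)) atTop (𝓝 0) := by
  rw [tendsto_zero_iff_abs_tendsto_zero]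
  simp only [Function.comp_def]
  refine (summable_of_sum_le (c := ‖F‖ * ‖u‖) (fun n => abs_nonneg (F (h n)))
    fun s => ?_).tendsto_atTop_zero
  set c : ℕ → ℝ := fun n => (SignType.sign (F (h n)) : ℝ) with hc
  have hc1 : ∀ n, |c n| ≤ 1 := fun n => by
    simp only [hc]
    rcases SignType.sign (F (h n)) <;> simp
  have h₁ : ∑ n ∈ s, |F (h n)| = F (∑ n ∈ s, c n • h n) := by
    simp only [map_sum, map_smul, smul_eq_mul, hc, sign_mul_self]
  have h₂ : ‖∑ n ∈ s, c n • h n‖ ≤ ‖u‖ := by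
    refine ContinuousLinearMap.opNorm_le_bound _ (norm_nonneg u) fun x => ?_
    calc ‖(∑ n ∈ s, c n • h n) x‖ = |∑ n ∈ s, c n * h n x| := by
          simp [Real.norm_eq_abs]
      _ ≤ ∑ n ∈ s, |c n * h n x| := Finset.abs_sum_le_sum_abs _ _
      _ ≤ ∑ n ∈ s, h n |x| := Finset.sum_le_sum fun n _ => by
          rw [abs_mul]
          exact (mul_le_of_le_one_left (abs_nonneg _) (hc1 n)).trans
            (abs_apply_le_apply_abs (hh n) x)
      _ ≤ u |x| := hsum s _ (abs_nonneg x)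
      _ ≤ ‖u‖ * ‖|x|‖ := (Real.le_norm_self _).trans (u.le_opNorm _)
      _ = ‖u‖ * ‖x‖ := by rw [norm_abs_eq_norm]
  rw [h₁]
  exact (Real.le_norm_self _).trans ((F.le_opNorm _).trans (by gcongr))

theorem uawTendsto_zero_of_isCarriedBy {y : ℕ → E} (hy : IsDisjointSeq y) (hy0 : ∀ n, 0 ≤ y n)
    {g : ℕ → StrongDual ℝ E} (hg : ∀ n, 0 ≤ g n) (hc : ∀ n, IsCarriedBy (g n) (y n)) :
    UawTendsto g 0 := fun u hu => by
  have heq : (fun n => toWeakSpace ℝ (StrongDual ℝ E) (|g n - 0| ⊓ u)) =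
      fun n => toWeakSpace ℝ (StrongDual ℝ E) (g n ⊓ u) := by
    funext n
    rw [sub_zero, abs_of_nonneg (hg n)]
  rw [heq, tendsto_toWeakSpace_zero_iff]
  have h0 : ∀ n, 0 ≤ g n ⊓ u := fun n => le_inf (hg n) hu
  exact tendsto_dual_apply_of_sum_apply_le h0 fun s x hx =>
    sum_apply_le_of_isCarriedBy hy hy0 (fun _ => inf_le_right) hu
      (fun n => (hc n).mono (h0 n) inf_le_left) s hx

theorem exists_isCarriedBy_apply_eq_norm {y : E} (hy : 0 ≤ y) :
    ∃ g : StrongDual ℝ E, 0 ≤ g ∧ ‖g‖ ≤ 1 ∧ g y = ‖y‖ ∧ IsCarriedBy g y := by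
  obtain ⟨φ, hφ, hφy⟩ := exists_dual_vector'' ℝ y
  have hf : 0 ≤ dualPosPart φ := fun x hx => by
    rw [dualPosPart_apply _ hx]
    exact supOnIcc_nonneg φ hx
  have hf1 : ‖dualPosPart φ‖ ≤ 1 := (norm_dualPosPart_le φ).trans hφ
  have hle : ∀ x, dualPosPart φ x ≤ ‖x‖ := fun x =>
    (Real.le_norm_self _).trans (by simpa using (dualPosPart φ).le_of_opNorm_le hf1 x)
  have hfy : dualPosPart φ y = ‖y‖ := by
    refine le_antisymm (hle y) ?_
    rw [dualPosPart_apply _ hy]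
    exact hφy.ge.trans (le_supOnIcc φ ⟨hy, le_rfl⟩)
  obtain ⟨g, hg, hgf, hgy, hc⟩ := exists_isCarriedBy_of_nonneg hf hy
  refine ⟨g, hg, ContinuousLinearMap.opNorm_le_bound _ zero_le_one fun x => ?_, hgy.trans hfy, hc⟩
  rw [one_mul, ← norm_abs_eq_norm x]
  exact (abs_apply_le_apply_abs hg x).trans ((hgf _ (abs_nonneg x)).trans (hle _))

theorem disjointNull_of_tendsto_apply {S : Set E} (hS : LatticeOrderedAddCommGroup.IsSolid S)
    (h : ∀ f : ℕ → StrongDual ℝ E, Bornology.IsBounded (range f) → UawTendsto f 0 →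
      ∀ x : ℕ → E, IsDisjointSeq x → (∀ n, x n ∈ {y : E | 0 ≤ y} ∩ S) →
        Tendsto (fun n => f n (x n)) atTop (𝓝 0)) : DisjointNull S := fun x hx hxS => by
  have hdisj : IsDisjointSeq fun n => |x n| := fun i j hij => by
    simpa only [abs_abs] using hx hij
  choose g hg hg1 hgx hc using fun n => exists_isCarriedBy_apply_eq_norm (abs_nonneg (x n))
  have hb : Bornology.IsBounded (range g) := isBounded_iff_forall_norm_le.2
    ⟨1, by rintro _ ⟨n, rfl⟩; exact hg1 n⟩
  have := h g hb (uawTendsto_zero_of_isCarriedBy hdisj (fun n => abs_nonneg _) hg hc) _ hdisj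
    fun n => ⟨abs_nonneg (x n), hS (hxS n) (abs_abs _).le⟩
  simpa only [hgx, norm_abs_eq_norm] using this

end Sufficiency

end BanachLattice

theorem mainTheorem3 {E : Type*} [NormedAddCommGroup E] [NormedSpace ℝ E] [CompleteSpace E]
    [Lattice E] [HasSolidNorm E] [IsOrderedAddMonoid E] [IsOrderedModule ℝ E]
    (A : Set E) (hne : A.Nonempty) (hA : Bornology.IsBounded A) :
    List.TFAE [
      BanachLattice.IsLWeaklyCompact A,
      ∀ f : ℕ → StrongDual ℝ E, Bornology.IsBounded (Set.range f) →
        BanachLattice.UawTendsto f 0 →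
        ∀ x : ℕ → E,
          (∀ n, x n ∈ {y : E | 0 ≤ y} ∩ LatticeOrderedAddCommGroup.solidClosure A) →
          Tendsto (fun n => f n (x n)) atTop (𝓝 0),
      ∀ f : ℕ → StrongDual ℝ E, Bornology.IsBounded (Set.range f) →
        BanachLattice.UawTendsto f 0 →
        ∀ x : ℕ → E, BanachLattice.IsDisjointSeq x →
          (∀ n, x n ∈ {y : E | 0 ≤ y} ∩ LatticeOrderedAddCommGroup.solidClosure A) →
          Tendsto (fun n => f n (x n)) atTop (𝓝 0)] := by

  have hS := LatticeOrderedAddCommGroup.isSolid_solidClosure A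
  tfae_have 1 → 2 := fun h f hf hf0 x hx =>
    BanachLattice.DisjointNull.tendsto_apply_of_uawTendsto h.2.2 hS
      (BanachLattice.isBounded_solidClosure hA) hf hf0 (fun n => (hx n).1) fun n => (hx n).2
  tfae_have 2 → 3 := fun h f hf hf0 x _ hx => h f hf hf0 x hx
  tfae_have 3 → 1 := fun h => ⟨hne, hA, BanachLattice.disjointNull_of_tendsto_apply hS h⟩
  tfae_finish
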